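/- Let $\mathbb F_q$ be a finite field with $q$ elements whose characteristic is greater than $2$, let $d \ge 3$ be an odd integer, and let $E, F \subset \mathbb F_q^d$. Write $\|m\| = m_1^2 + \cdots + m_d^2$ for $m = (m_1,\dots,m_d) \in \mathbb F_q^d$, and let $\Delta(E,F) = \{\|x-y\| : x \in E,\ y \in F\} \subset \mathbb F_q$ be the distance set of $E$ and $F$. Then $$|\Delta(E,F)| \ge \begin{cases} \min\left\{\dfrac q2, \dfrac{|E||F|}{8q^{d-1}}\right\} & \text{if } 1 \le |E| < q^{\frac{d-1}2},\\[2ex] \min\left\{\dfrac q2, \dfrac{|F|}{8q^{\frac{d-1}2}}\right\} & \text{if } q^{\frac{d-1}2} \le |E| < q^{\frac{d+1}2},\\[2ex] \min\left\{\dfrac q2, \dfrac{|E||F|}{2q^{d}}\right\} & \text{if } q^{\frac{d+1}2} \le |E| \le q^d. \end{cases}$$ Moreover, $|\Delta(E,F)| > 1$ whenever $|E||F| > 8q^{d-1}$. -/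

import Mathlib

/-- The (non-metric) "norm" `‖m‖ = m₁² + ⋯ + m_d²` on `K ^ d`. -/
def sqNorm {K : Type*} [Field K] {d : ℕ} (m : Fin d → K) : K :=
  ∑ i, m i ^ 2

/-- The distance set `Δ(E, F) = {‖x - y‖ : x ∈ E, y ∈ F} ⊆ K` of two finite sets. -/
def distSet {K : Type*} [Field K] [DecidableEq K] {d : ℕ} (E F : Finset (Fin d → K)) :
    Finset K :=
  (E ×ˢ F).image fun p => sqNorm (p.1 - p.2)

/-! Let ν(t) count the pairs at distance t. Cauchy–Schwarz gives (|E||F|)² ≤ |Δ(E,F)| Σ ν(t)², so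
the second moment of ν must be bounded. By Parseval it is an average over u of |Σ χ(u‖x-y‖)|²; u = 0
gives the main term. For u ≠ 0 the Fourier transform of a Gaussian turns the sum into one over
frequencies, and a second Parseval groups these by spheres ‖m‖ = r. Cauchy–Schwarz on each sphere
leaves |F| times an L² bound M for the transform of E on spheres (`sum_distCount_sq_le`).

Plancherel gives M = q^d|E|, enough for large E. For d = 2k+1, an odd power of a Gauss sum keeps the
quadratic character, so the sphere's transform is a Salié sum, of size at most 2q. This gives M =
q^(2k)|E| + 2q^k|E|² for every radius, zero included (`sum_sphere_norm_sq_indicatorFourier_le`), and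
hence the other two ranges. -/

open Finset AddChar ComplexConjugate

/-! ### Gauss and Salié sums -/

section CharacterSums

variable {K : Type*} [Field K] [Fintype K] {χ : AddChar K ℂ}

/-- Orthogonality of additive characters on a finite field. -/
theorem sum_addChar_mul [DecidableEq K] (hχ : χ.IsPrimitive) (b : K) :
    ∑ u, χ (u * b) = if b = 0 then (Fintype.card K : ℂ) else 0 := by
  rw [AddChar.sum_mulShift b hχ]
  split_ifs <;> simp

/-- Parseval's identity for the push-forward of `a` along `f`. -/
theorem sum_norm_sq_sum_addChar [DecidableEq K] (hχ : χ.IsPrimitive) {ι : Type*} (s : Finset ι)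
    (f : ι → K) (a : ι → ℂ) :
    ∑ u, ‖∑ i ∈ s, χ (u * f i) * a i‖ ^ 2 =
      Fintype.card K * ∑ r, ‖∑ i ∈ s with f i = r, a i‖ ^ 2 := by
  have hC : ((∑ u, ‖∑ i ∈ s, χ (u * f i) * a i‖ ^ 2 : ℝ) : ℂ) =
      ((Fintype.card K * ∑ r, ‖∑ i ∈ s with f i = r, a i‖ ^ 2 : ℝ) : ℂ) := by
    push_cast
    simp only [← Complex.mul_conj', map_sum, sum_filter, mul_sum, sum_mul]
    rw [sum_comm, sum_comm (s := univ)]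
    refine sum_congr rfl fun j _ => ?_
    rw [sum_comm, sum_comm (s := univ)]
    refine sum_congr rfl fun i _ => ?_
    calc ∑ u, χ (u * f i) * a i * conj (χ (u * f j) * a j)
        = ∑ u, χ (u * (f i - f j)) * (a i * conj (a j)) := by
          refine sum_congr rfl fun u _ => ?_
          rw [mul_sub, sub_eq_add_neg, AddChar.map_add_eq_mul, AddChar.map_neg_eq_conj,
            RingHom.map_mul]
          ring
      _ = if f i = f j then Fintype.card K * (a i * conj (a j)) else 0 := by
          simp [← sum_mul, sum_addChar_mul hχ, sub_eq_zero]
      _ = _ := by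
          simp [apply_ite conj, eq_comm]
  exact_mod_cast hC

/-- The quadratic Gauss sum `∑ x, χ (s x²)`. -/
noncomputable def quadGaussSum (χ : AddChar K ℂ) (s : K) : ℂ := ∑ x, χ (s * x ^ 2)

theorem sum_addChar_quadratic (h2 : (2 : K) ≠ 0) {s : K} (hs : s ≠ 0) (z : K) :
    ∑ x, χ (s * x ^ 2 + x * z) = quadGaussSum χ s * χ (-(z ^ 2) / (4 * s)) := by
  rw [quadGaussSum, ← Equiv.sum_comp (Equiv.addRight (z / (2 * s))) fun x => χ (s * x ^ 2), sum_mul]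
  refine sum_congr rfl fun x _ => ?_
  rw [← AddChar.map_add_eq_mul]
  congr 1
  have h4 : (4 : K) ≠ 0 := by
    have : (4 : K) = 2 * 2 := by norm_num
    simp [this, h2]
  simp only [Equiv.coe_addRight]
  field_simp
  ring

theorem norm_quadGaussSum_sq (hχ : χ.IsPrimitive) (h2 : (2 : K) ≠ 0) {s : K} (hs : s ≠ 0) :
    ‖quadGaussSum χ s‖ ^ 2 = Fintype.card K := by
  classical
  have hC : ((‖quadGaussSum χ s‖ ^ 2 : ℝ) : ℂ) = ((Fintype.card K : ℝ) : ℂ) := by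
    push_cast
    rw [← Complex.mul_conj', quadGaussSum, map_sum, sum_mul_sum, sum_comm]
    calc ∑ y, ∑ x, χ (s * x ^ 2) * conj (χ (s * y ^ 2))
        = ∑ y, ∑ u, χ (s * u ^ 2) * χ (y * (2 * s * u)) := by
          refine sum_congr rfl fun y _ => ?_
          -- With x = u + y the phase is linear in y, so summing over y leaves only u = 0.
          rw [← Equiv.sum_comp (Equiv.addRight y)]
          refine sum_congr rfl fun u _ => ?_
          rw [← AddChar.map_neg_eq_conj, ← AddChar.map_add_eq_mul, ← AddChar.map_add_eq_mul]
          congr 1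
          simp only [Equiv.coe_addRight]
          ring
      _ = Fintype.card K := by
          rw [sum_comm]
          simp_rw [← mul_sum, sum_addChar_mul hχ]
          simp [h2, hs]
  exact_mod_cast hC

/-- The equation x² = y has 1 + η(y) roots, η the quadratic character; the 1 sums to zero against χ,
and y ↦ ys pulls out η(s). -/
theorem quadGaussSum_eq_mul [DecidableEq K] (hχ : χ.IsPrimitive) (hK : ringChar K ≠ 2) {s : K}
    (hs : s ≠ 0) : quadGaussSum χ s = quadraticChar K s * quadGaussSum χ 1 := by
  have key : ∀ t : K, t ≠ 0 → quadGaussSum χ t = ∑ y, (quadraticChar K y : ℂ) * χ (y * t) := by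
    intro t ht
    calc quadGaussSum χ t = ∑ y, ∑ x with x ^ 2 = y, χ (t * x ^ 2) := by
          rw [quadGaussSum, sum_fiberwise]
      _ = ∑ y, ((quadraticChar K y : ℂ) + 1) * χ (y * t) := by
          refine sum_congr rfl fun y _ => ?_
          rw [sum_congr rfl (g := fun _ => χ (y * t)), sum_const, nsmul_eq_mul]
          · congr 1
            have := quadraticChar_card_sqrts hK y
            rw [Set.toFinset_ofPred] at this
            exact_mod_cast this
          · intro x hx
            rw [(mem_filter.1 hx).2, mul_comm]
      _ = _ := by
          simp_rw [add_mul, one_mul, sum_add_distrib, sum_addChar_mul hχ, if_neg ht, add_zero]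
  rw [key s hs, key 1 one_ne_zero, mul_sum, 
    ← Equiv.sum_comp (Equiv.mulRight₀ s hs) fun y =>
      quadraticChar K s * (quadraticChar K y * χ (y * 1))]
  refine sum_congr rfl fun y _ => ?_
  have h1 : (quadraticChar K s : ℂ) * quadraticChar K s = 1 := by
    have := quadraticChar_sq_one hs
    rw [sq] at this
    exact_mod_cast this
  simp only [Equiv.mulRight₀_apply, map_mul, mul_one, Int.cast_mul]
  linear_combination -(quadraticChar K y : ℂ) * χ (y * s) * h1

/-- Evaluation of a Salié sum by completing the square. -/
theorem sum_quadGaussSum_mul_of_sq [DecidableEq K] (hχ : χ.IsPrimitive) (a c : K) :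
    ∑ s ∈ univ.erase 0, quadGaussSum χ s * χ (a * s - c ^ 2 / s) =
      Fintype.card K * (∑ x with x ^ 2 + a = 0, χ (2 * c * x) - if 2 * c = 0 then 1 else 0) := by
  have h1 : ∀ s ∈ univ.erase (0 : K), quadGaussSum χ s * χ (a * s - c ^ 2 / s) =
      ∑ x, χ (s * (x ^ 2 + a)) * χ (2 * c * x) := by
    intro s hs
    have hs : s ≠ 0 := ne_of_mem_erase hs
    -- The shift by c/s cancels c²/s, so the phase becomes linear in s.
    rw [quadGaussSum, ← Equiv.sum_comp (Equiv.addRight (c / s)), sum_mul]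
    refine sum_congr rfl fun x _ => ?_
    rw [← AddChar.map_add_eq_mul, ← AddChar.map_add_eq_mul]
    congr 1
    simp only [Equiv.coe_addRight]
    field_simp
    ring
  have h2 : ∑ x, χ (2 * c * x) = if 2 * c = 0 then (Fintype.card K : ℂ) else 0 := by
    simp_rw [mul_comm (2 * c), sum_addChar_mul hχ]
  rw [sum_congr rfl h1, sum_erase_eq_sub (mem_univ _), sum_comm]
  simp_rw [← sum_mul, sum_addChar_mul hχ, ite_mul, zero_mul, AddChar.map_zero_eq_one, one_mul, h2,
    mul_sub, sum_filter, mul_sum]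
  congr 1
  · exact sum_congr rfl fun x _ => by split_ifs <;> simp
  · split_ifs <;> simp

/-- When b is a square, the explicit evaluation has at most two unimodular terms; any other b
reduces to this case by rescaling s. -/
theorem norm_sum_quadGaussSum_mul_le [DecidableEq K] (hχ : χ.IsPrimitive) (hK : ringChar K ≠ 2)
    (a b : K) :
    ‖∑ s ∈ univ.erase 0, quadGaussSum χ s * χ (a * s - b / s)‖ ≤ 2 * Fintype.card K := by
  have h2 : (2 : K) ≠ 0 := Ring.two_ne_zero hK
  have hsq : ∀ a c : K,
      ‖∑ s ∈ univ.erase 0, quadGaussSum χ s * χ (a * s - c ^ 2 / s)‖ ≤ 2 * Fintype.card K := by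
    intro a c
    have hcard : #{x : K | x ^ 2 + a = 0} ≤ 2 := by
      have := quadraticChar_card_sqrts hK (-a)
      rw [Set.toFinset_ofPred] at this
      simp_rw [← eq_neg_iff_add_eq_zero]
      have h3 : quadraticChar K (-a) ≤ 1 := by
        rcases eq_or_ne (-a) 0 with h | h
        · simp [h]
        · rcases quadraticChar_dichotomy h with h | h <;> simp [h]
      omega
    rw [sum_quadGaussSum_mul_of_sq hχ, norm_mul, Complex.norm_natCast, mul_comm]
    refine mul_le_mul_of_nonneg_right ?_ (Nat.cast_nonneg _)
    rcases eq_or_ne c 0 with rfl | hc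
    · simp only [mul_zero, zero_mul, AddChar.map_zero_eq_one, sum_const, nsmul_eq_mul, mul_one,
        if_true]
      interval_cases #{x : K | x ^ 2 + a = 0} <;> norm_num
    · rw [if_neg (mul_ne_zero h2 hc), sub_zero]
      refine (norm_sum_le _ _).trans ?_
      simp only [AddChar.norm_apply, sum_const, nsmul_eq_mul, mul_one]
      exact_mod_cast hcard
  by_cases hb : b = 0
  · simpa [hb] using hsq a 0
  have hη : ‖(quadraticChar K b : ℂ)‖ = 1 := by
    rcases quadraticChar_dichotomy hb with h | h <;> simp [h]
  -- Replacing s by bs turns b into b², at the cost of a sign from the Gauss sum.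
  have : ∑ s ∈ univ.erase 0, quadGaussSum χ s * χ (a * s - b / s) = quadraticChar K b *
      ∑ s ∈ univ.erase 0, quadGaussSum χ s * χ (a / b * s - b ^ 2 / s) := by
    rw [mul_sum]
    refine sum_bij' (fun s _ => b * s) (fun s _ => s / b) ?_ ?_ ?_ ?_ ?_
    · intro s hs
      simpa [hb] using hs
    · intro s hs
      simpa [hb] using hs
    · intro s hs
      field_simp
    · intro s hs
      field_simp
    · intro s hs
      have hs : s ≠ 0 := ne_of_mem_erase hs
      have h1 : (quadraticChar K b : ℂ) * quadraticChar K b = 1 := by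
        have := quadraticChar_sq_one hb
        rw [sq] at this
        exact_mod_cast this
      have h3 : a / b * (b * s) - b ^ 2 / (b * s) = a * s - b / s := by
        field_simp
      rw [h3, quadGaussSum_eq_mul hχ hK hs, quadGaussSum_eq_mul hχ hK (mul_ne_zero hb hs)]
      simp only [map_mul, Int.cast_mul]
      linear_combination -(quadraticChar K s : ℂ) * quadGaussSum χ 1 * χ (a * s - b / s) * h1
  rw [this, norm_mul, hη, one_mul]
  exact hsq _ _

end CharacterSums

theorem AddChar.map_sum_eq_prod {A R ι : Type*} [AddCommMonoid A] [CommMonoid R] (ψ : AddChar A R)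
    (s : Finset ι) (f : ι → A) : ψ (∑ i ∈ s, f i) = ∏ i ∈ s, ψ (f i) := by
  classical
  induction s using Finset.induction_on with
  | empty => simp
  | insert i s hi ih => rw [sum_insert hi, prod_insert hi, AddChar.map_add_eq_mul, ih]

/-- The number of pairs in `E × F` at distance `t`. -/
def distCount {K : Type*} [Field K] [DecidableEq K] {d : ℕ} (E F : Finset (Fin d → K)) (t : K) : ℕ :=
  #{p ∈ E ×ˢ F | sqNorm (p.1 - p.2) = t}

theorem sum_distCount {K : Type*} [Field K] [DecidableEq K] {d : ℕ} (E F : Finset (Fin d → K)) :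
    ∑ t ∈ distSet E F, distCount E F t = #E * #F := by
  rw [← card_product]
  exact (card_eq_sum_card_image _ _).symm

/-! ### Fourier transforms on spheres and the second moment -/

section Fourier

variable {K : Type*} [Field K] [Fintype K] {χ : AddChar K ℂ} {d : ℕ}

theorem sum_addChar_dotProduct [DecidableEq K] (hχ : χ.IsPrimitive) (z : Fin d → K) :
    ∑ m, χ (m ⬝ᵥ z) = if z = 0 then (Fintype.card K : ℂ) ^ d else 0 := by
  simp_rw [dotProduct, AddChar.map_sum_eq_prod]
  rw [← Fintype.prod_sum fun i x => χ (x * z i)]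
  simp_rw [sum_addChar_mul hχ]
  split_ifs with h
  · simp [h]
  · obtain ⟨i, hi⟩ := Function.ne_iff.1 h
    exact prod_eq_zero (mem_univ i) (if_neg hi)

/-- The Fourier transform of a Gaussian on `K ^ d`. -/
theorem sum_addChar_sqNorm_add_dotProduct (h2 : (2 : K) ≠ 0) {s : K} (hs : s ≠ 0)
    (z : Fin d → K) :
    ∑ m, χ (s * sqNorm m + m ⬝ᵥ z) = quadGaussSum χ s ^ d * χ (-sqNorm z / (4 * s)) := by
  simp_rw [dotProduct, sqNorm, mul_sum, ← sum_add_distrib, AddChar.map_sum_eq_prod]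
  rw [← Fintype.prod_sum fun i x => χ (s * x ^ 2 + x * z i)]
  simp_rw [sum_addChar_quadratic h2 hs, prod_mul_distrib, prod_const, card_univ, Fintype.card_fin,
    ← AddChar.map_sum_eq_prod, ← sum_div, sum_neg_distrib]

/-- The (unnormalised) Fourier transform of the indicator function of `E`. -/
noncomputable def indicatorFourier (χ : AddChar K ℂ) (E : Finset (Fin d → K)) (m : Fin d → K) : ℂ :=
  ∑ x ∈ E, χ (m ⬝ᵥ x)

theorem indicatorFourier_mul_conj (E F : Finset (Fin d → K)) (m : Fin d → K) :
    indicatorFourier χ E m * conj (indicatorFourier χ F m) =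
      ∑ p ∈ E ×ˢ F, χ (m ⬝ᵥ (p.1 - p.2)) := by
  simp only [indicatorFourier, map_sum, sum_mul_sum, sum_product]
  refine sum_congr rfl fun x _ => sum_congr rfl fun y _ => ?_
  rw [dotProduct_sub, sub_eq_add_neg, AddChar.map_add_eq_mul, AddChar.map_neg_eq_conj]

theorem sum_norm_sq_indicatorFourier (hχ : χ.IsPrimitive) (E : Finset (Fin d → K)) :
    ∑ m, ‖indicatorFourier χ E m‖ ^ 2 = (Fintype.card K : ℝ) ^ d * #E := by
  classical
  have hC : ((∑ m, ‖indicatorFourier χ E m‖ ^ 2 : ℝ) : ℂ) =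
      (((Fintype.card K : ℝ) ^ d * #E : ℝ) : ℂ) := by
    push_cast
    simp_rw [← Complex.mul_conj', indicatorFourier_mul_conj]
    rw [sum_comm]
    simp_rw [sum_addChar_dotProduct hχ, sub_eq_zero, sum_product]
    simp [mul_comm]
  exact_mod_cast hC

/-- Uniform bound for the nontrivial part of the Fourier transform of a sphere in odd dimension. -/
theorem norm_sum_quadGaussSum_pow_le (hχ : χ.IsPrimitive) [DecidableEq K] (hK : ringChar K ≠ 2)
    (k : ℕ) (a b : K) :
    ‖∑ s ∈ univ.erase 0, quadGaussSum χ s ^ (2 * k + 1) * χ (a * s - b / s)‖ ≤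
      2 * (Fintype.card K : ℝ) ^ (k + 1) := by
  have h2 : (2 : K) ≠ 0 := Ring.two_ne_zero hK
  have h : ∀ s ∈ univ.erase (0 : K), quadGaussSum χ s ^ (2 * k + 1) * χ (a * s - b / s) =
      quadGaussSum χ 1 ^ (2 * k) * (quadGaussSum χ s * χ (a * s - b / s)) := by
    intro s hs
    have hs : s ≠ 0 := ne_of_mem_erase hs
    have h1 : (quadraticChar K s : ℂ) ^ 2 = 1 := by exact_mod_cast quadraticChar_sq_one hs
    rw [pow_succ, mul_assoc]
    congr 1
    rw [quadGaussSum_eq_mul hχ hK hs, mul_pow, pow_mul, h1, one_pow, one_mul]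
  rw [sum_congr rfl h, ← mul_sum, norm_mul, norm_pow, pow_mul, norm_quadGaussSum_sq hχ h2 one_ne_zero]
  calc _ ≤ (Fintype.card K : ℝ) ^ k * (2 * Fintype.card K) := by
        gcongr
        exact norm_sum_quadGaussSum_mul_le hχ hK a b
    _ = _ := by ring

/-- The Fourier restriction estimate for spheres of arbitrary radius in odd dimension. -/
theorem sum_sphere_norm_sq_indicatorFourier_le [DecidableEq K] (hχ : χ.IsPrimitive)
    (hK : ringChar K ≠ 2) {k : ℕ} (E : Finset (Fin (2 * k + 1) → K)) (r : K) :
    ∑ m with sqNorm m = r, ‖indicatorFourier χ E m‖ ^ 2 ≤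
      (Fintype.card K : ℝ) ^ (2 * k) * #E + 2 * (Fintype.card K : ℝ) ^ k * (#E : ℝ) ^ 2 := by
  have h2 : (2 : K) ≠ 0 := Ring.two_ne_zero hK
  set q : ℝ := (Fintype.card K : ℝ) with hq
  have hq0 : 0 < q := by rw [hq]; exact_mod_cast Fintype.card_pos
  have key : ((q * ∑ m with sqNorm m = r, ‖indicatorFourier χ E m‖ ^ 2 : ℝ) : ℂ) =
      ((q ^ (2 * k + 1) * #E : ℝ) : ℂ) + ∑ p ∈ E ×ˢ E, ∑ u ∈ univ.erase 0,
        quadGaussSum χ u ^ (2 * k + 1) * χ (-r * u - (sqNorm (p.1 - p.2) / 4) / u) := by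
    have e1 : ∀ u ∈ univ.erase (0 : K), ∑ m : Fin (2 * k + 1) → K,
        χ (u * (sqNorm m - r)) * ((‖indicatorFourier χ E m‖ ^ 2 : ℝ) : ℂ) = ∑ p ∈ E ×ˢ E,
        quadGaussSum χ u ^ (2 * k + 1) * χ (-r * u - (sqNorm (p.1 - p.2) / 4) / u) := by
      intro u hu
      have hu : u ≠ 0 := ne_of_mem_erase hu
      push_cast
      simp_rw [← Complex.mul_conj', indicatorFourier_mul_conj, mul_sum]
      rw [sum_comm]
      refine sum_congr rfl fun p _ => ?_
      calc _ = χ (-r * u) * ∑ m, χ (u * sqNorm m + m ⬝ᵥ (p.1 - p.2)) := by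
            rw [mul_sum]
            refine sum_congr rfl fun m _ => ?_
            rw [← AddChar.map_add_eq_mul, ← AddChar.map_add_eq_mul]
            congr 1
            ring
        _ = _ := by
            rw [sum_addChar_sqNorm_add_dotProduct h2 hu, mul_left_comm, ← AddChar.map_add_eq_mul,
              neg_div, ← sub_eq_add_neg, div_div]
    calc _ = ∑ m : Fin (2 * k + 1) → K, ∑ u, χ (u * (sqNorm m - r)) *
            ((‖indicatorFourier χ E m‖ ^ 2 : ℝ) : ℂ) := by
          simp_rw [← sum_mul, sum_addChar_mul hχ, sub_eq_zero, ite_mul, zero_mul, ← sum_filter,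
            ← mul_sum]
          push_cast
          rfl
      _ = _ := by
          -- The term u = 0 is Plancherel; the others are Salié-type sums.
          rw [sum_comm, ← add_sum_erase _ _ (mem_univ (0 : K)), sum_congr rfl e1, sum_comm (s := E ×ˢ E),
            ← sum_norm_sq_indicatorFourier hχ]
          simp
  have hle : q * ∑ m with sqNorm m = r, ‖indicatorFourier χ E m‖ ^ 2 ≤
      q ^ (2 * k + 1) * #E + (#E * #E) * (2 * q ^ (k + 1)) := by
    calc _ = ‖((q * ∑ m with sqNorm m = r, ‖indicatorFourier χ E m‖ ^ 2 : ℝ) : ℂ)‖ := by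
          rw [Complex.norm_real, Real.norm_of_nonneg (by positivity)]
      _ ≤ ‖((q ^ (2 * k + 1) * #E : ℝ) : ℂ)‖ + ∑ p ∈ E ×ˢ E, 2 * q ^ (k + 1) := by
          rw [key]
          refine (norm_add_le _ _).trans (add_le_add_right ((norm_sum_le _ _).trans ?_) _)
          exact sum_le_sum fun p _ => norm_sum_quadGaussSum_pow_le hχ hK k _ _
      _ = _ := by
          rw [Complex.norm_real, Real.norm_of_nonneg (by positivity), sum_const, card_product,
            nsmul_eq_mul]
          push_cast
          rfl
  refine le_of_mul_le_mul_left (hle.trans_eq ?_) hq0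
  ring

/-- An exponential sum over the distances is dual to one over the frequencies. -/
theorem norm_sq_sum_addChar_sqNorm (hχ : χ.IsPrimitive) (h2 : (2 : K) ≠ 0)
    (E F : Finset (Fin d → K)) {s : K} (hs : s ≠ 0) :
    (Fintype.card K : ℝ) ^ d * ‖∑ p ∈ E ×ˢ F, χ (s * sqNorm (p.1 - p.2))‖ ^ 2 =
      ‖∑ m, χ (-(4 * s)⁻¹ * sqNorm m) *
        (indicatorFourier χ E m * conj (indicatorFourier χ F m))‖ ^ 2 := by
  have h4 : (4 : K) ≠ 0 := by
    have : (4 : K) = 2 * 2 := by norm_num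
    simp [this, h2]
  have hu : -(4 * s)⁻¹ ≠ 0 := by simp [h4, hs]
  have : ∑ m, χ (-(4 * s)⁻¹ * sqNorm m) *
        (indicatorFourier χ E m * conj (indicatorFourier χ F m)) =
      quadGaussSum χ (-(4 * s)⁻¹) ^ d * ∑ p ∈ E ×ˢ F, χ (s * sqNorm (p.1 - p.2)) := by
    simp_rw [indicatorFourier_mul_conj, mul_sum]
    rw [sum_comm]
    refine sum_congr rfl fun p _ => ?_
    simp_rw [← AddChar.map_add_eq_mul]
    rw [sum_addChar_sqNorm_add_dotProduct h2 hu]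
    congr 2
    field_simp
  rw [this, norm_mul, mul_pow, norm_pow, ← pow_mul, mul_comm d, pow_mul,
    norm_quadGaussSum_sq hχ h2 hu]

/-- The second moment of the distance counts, in terms of an `L²` restriction bound `M`. -/
theorem sum_distCount_sq_le [DecidableEq K] (hχ : χ.IsPrimitive) (h2 : (2 : K) ≠ 0)
    (E F : Finset (Fin d → K)) {M : ℝ}
    (hM : ∀ r, ∑ m with sqNorm m = r, ‖indicatorFourier χ E m‖ ^ 2 ≤ M) :
    (Fintype.card K : ℝ) * ∑ t, (distCount E F t : ℝ) ^ 2 ≤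
      ((#E : ℝ) * #F) ^ 2 + Fintype.card K * (#F * M) := by
  set q : ℝ := (Fintype.card K : ℝ) with hq
  have hq0 : 0 < q := by rw [hq]; exact_mod_cast Fintype.card_pos
  set a : (Fin d → K) → ℂ := fun m =>
    indicatorFourier χ E m * conj (indicatorFourier χ F m) with ha
  have e1 : q * ∑ t, (distCount E F t : ℝ) ^ 2 =
      ∑ u, ‖∑ p ∈ E ×ˢ F, χ (u * sqNorm (p.1 - p.2))‖ ^ 2 := by
    have := sum_norm_sq_sum_addChar hχ (E ×ˢ F) (fun p => sqNorm (p.1 - p.2)) fun _ => 1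
    simp only [mul_one, sum_const, nsmul_eq_mul, Complex.norm_natCast] at this
    exact this.symm
  have e2 : q ^ d * ∑ s ∈ univ.erase 0, ‖∑ p ∈ E ×ˢ F, χ (s * sqNorm (p.1 - p.2))‖ ^ 2 ≤
      q * ∑ r, ‖∑ m with sqNorm m = r, a m‖ ^ 2 := by
    -- Distinct s have distinct dual parameters, so the sum is part of the full Parseval sum.
    have hi : Set.InjOn (fun s : K => -(4 * s)⁻¹) (univ.erase (0 : K)) := by
      have h4 : (4 : K) ≠ 0 := by
        have : (4 : K) = 2 * 2 := by norm_num
        simp [this, h2]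
      intro x _ y _ h
      simpa [h4] using h
    rw [← sum_norm_sq_sum_addChar hχ univ sqNorm a, mul_sum,
      sum_congr rfl fun s hs => norm_sq_sum_addChar_sqNorm hχ h2 E F (ne_of_mem_erase hs),
      ← sum_image (f := fun u => ‖∑ m, χ (u * sqNorm m) * a m‖ ^ 2) hi]
    exact sum_le_sum_of_subset_of_nonneg (subset_univ _) fun _ _ _ => by positivity
  have e3 : ∑ r, ‖∑ m with sqNorm m = r, a m‖ ^ 2 ≤ q ^ d * (#F * M) := by
    calc _ ≤ ∑ r, M * ∑ m with sqNorm m = r, ‖indicatorFourier χ F m‖ ^ 2 := by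
          refine sum_le_sum fun r _ => ?_
          calc _ ≤ (∑ m with sqNorm m = r,
                  ‖indicatorFourier χ E m‖ * ‖indicatorFourier χ F m‖) ^ 2 := by
                gcongr
                refine (norm_sum_le _ _).trans_eq (sum_congr rfl fun m _ => ?_)
                rw [ha, norm_mul, RCLike.norm_conj]
            _ ≤ _ := sum_mul_sq_le_sq_mul_sq _ _ _
            _ ≤ _ := by
                gcongr
                exact hM r
      _ = _ := by
          rw [← mul_sum, sum_fiberwise, sum_norm_sq_indicatorFourier hχ]
          ring
  have e4 : ∑ s ∈ univ.erase 0, ‖∑ p ∈ E ×ˢ F, χ (s * sqNorm (p.1 - p.2))‖ ^ 2 ≤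
      q * (#F * M) := by
    refine le_of_mul_le_mul_left (e2.trans ?_) (pow_pos hq0 d)
    calc _ ≤ q * (q ^ d * (#F * M)) := by gcongr
      _ = _ := by ring
  rw [e1, ← add_sum_erase _ _ (mem_univ (0 : K))]
  refine add_le_add (le_of_eq ?_) e4
  simp

/-- Cauchy–Schwarz lower bound for the size of the distance set. -/
theorem card_distSet_lower [DecidableEq K] (hχ : χ.IsPrimitive) (h2 : (2 : K) ≠ 0)
    (E F : Finset (Fin d → K)) {M : ℝ}
    (hM : ∀ r, ∑ m with sqNorm m = r, ‖indicatorFourier χ E m‖ ^ 2 ≤ M) :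
    (Fintype.card K : ℝ) * ((#E : ℝ) * #F) ^ 2 ≤
      #(distSet E F) * (((#E : ℝ) * #F) ^ 2 + Fintype.card K * (#F * M)) := by
  have h1 : ((#E : ℝ) * #F) ^ 2 ≤ #(distSet E F) * ∑ t, (distCount E F t : ℝ) ^ 2 := by
    calc ((#E : ℝ) * #F) ^ 2 = (∑ t ∈ distSet E F, (distCount E F t : ℝ)) ^ 2 := by
          rw [← Nat.cast_mul, ← sum_distCount]
          push_cast
          rfl
      _ ≤ #(distSet E F) * ∑ t ∈ distSet E F, (distCount E F t : ℝ) ^ 2 :=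
          sq_sum_le_card_mul_sum_sq
      _ ≤ _ := by
          gcongr
          exact subset_univ _
  calc _ ≤ (Fintype.card K : ℝ) * (#(distSet E F) * ∑ t, (distCount E F t : ℝ) ^ 2) := by gcongr
    _ = #(distSet E F) * (Fintype.card K * ∑ t, (distCount E F t : ℝ) ^ 2) := by ring
    _ ≤ _ := by
        gcongr
        exact sum_distCount_sq_le hχ h2 E F hM

end Fourier

/-! ### Lower bounds for distance sets -/

section DistanceSets

variable {K : Type*} [Field K] {d : ℕ}

theorem sqNorm_sub_comm (x y : Fin d → K) : sqNorm (x - y) = sqNorm (y - x) := by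
  simp only [sqNorm, Pi.sub_apply]
  exact sum_congr rfl fun i _ => by ring

variable [DecidableEq K]

theorem distSet_comm (E F : Finset (Fin d → K)) : distSet E F = distSet F E := by
  ext t
  simp only [distSet, mem_image, mem_product, Prod.exists]
  constructor <;> rintro ⟨x, y, ⟨hx, hy⟩, rfl⟩ <;> exact ⟨y, x, ⟨hy, hx⟩, sqNorm_sub_comm _ _⟩

variable [Fintype K]

theorem card_mul_le_card_distSet_mul_pow (hK : ringChar K ≠ 2) {E F : Finset (Fin d → K)}
    (hE : 0 < #E) (hF : 0 < #F) :
    (Fintype.card K : ℝ) * (#E * #F) ≤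
      #(distSet E F) * (#E * #F + Fintype.card K * (Fintype.card K : ℝ) ^ d) := by
  have hχ := FiniteField.primitiveChar_to_Complex_isPrimitive K
  have h := card_distSet_lower hχ (Ring.two_ne_zero hK) E F fun r =>
    (sum_le_sum_of_subset_of_nonneg (subset_univ _) fun _ _ _ => by positivity).trans_eq
      (sum_norm_sq_indicatorFourier hχ E)
  have hE' : (0 : ℝ) < #E := by exact_mod_cast hE
  have hF' : (0 : ℝ) < #F := by exact_mod_cast hF
  refine le_of_mul_le_mul_left ?_ (mul_pos hE' hF')
  linear_combination h

theorem card_mul_le_card_distSet_mul_of_odd (hK : ringChar K ≠ 2) {k : ℕ}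
    {E F : Finset (Fin (2 * k + 1) → K)} (hE : 0 < #E) (hF : 0 < #F) :
    (Fintype.card K : ℝ) * (#E * #F) ≤ #(distSet E F) * (#E * #F + Fintype.card K *
      ((Fintype.card K : ℝ) ^ (2 * k) + 2 * (Fintype.card K : ℝ) ^ k * #E)) := by
  have hχ := FiniteField.primitiveChar_to_Complex_isPrimitive K
  have h := card_distSet_lower hχ (Ring.two_ne_zero hK) E F
    (sum_sphere_norm_sq_indicatorFourier_le hχ hK E)
  have hE' : (0 : ℝ) < #E := by exact_mod_cast hE
  have hF' : (0 : ℝ) < #F := by exact_mod_cast hF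
  refine le_of_mul_le_mul_left ?_ (mul_pos hE' hF')
  linear_combination h

/-- If D were below both bounds, DN and DqB would each be less than qN/2. -/
theorem min_half_div_le_of_mul_le {q N B D : ℝ} (hN : 0 < N) (hB : 0 < B)
    (h : q * N ≤ D * (N + q * B)) (hq : 0 < q) : min (q / 2) (N / (2 * B)) ≤ D := by
  by_contra! hD
  obtain ⟨h1, h2⟩ := lt_min_iff.1 hD
  rw [lt_div_iff₀ (by positivity)] at h2
  have h3 := mul_lt_mul_of_pos_right h1 hN
  have h4 := mul_lt_mul_of_pos_left h2 hq
  linarith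

theorem one_lt_card_distSet_of_card_le (hK : ringChar K ≠ 2) {k : ℕ}
    {E F : Finset (Fin (2 * k + 1) → K)} (hEF : #E ≤ #F)
    (h : 8 * Fintype.card K ^ (2 * k) < #E * #F) : 1 < #(distSet E F) := by
  by_contra! hD
  have hpos : 0 < #E * #F := by omega
  have hE : 0 < #E := Nat.pos_of_mul_pos_right hpos
  have hF : 0 < #F := Nat.pos_of_mul_pos_left hpos
  have hA := card_mul_le_card_distSet_mul_pow hK hE hF
  have hB := card_mul_le_card_distSet_mul_of_odd hK hE hF
  have hq3 : 3 ≤ Fintype.card K := by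
    have h1 := Fintype.one_lt_card (α := K)
    have h2 := FiniteField.odd_card_of_char_ne_two hK
    omega
  generalize Fintype.card K = q at *
  have hD' : (#(distSet E F) : ℝ) ≤ 1 := by exact_mod_cast hD
  have hsq : (#E : ℝ) * #E ≤ #E * #F := by gcongr
  have h' : 8 * ((q : ℝ) ^ k) ^ 2 < #E * #F := by
    rw [← pow_mul, mul_comm k]
    exact_mod_cast h
  have hp : 0 < (q : ℝ) ^ k := by positivity
  have hA := hA.trans (mul_le_of_le_one_left (by positivity) hD')
  have hB := hB.trans (mul_le_of_le_one_left (by positivity) hD')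
  have hpow : (q : ℝ) ^ (2 * k) = ((q : ℝ) ^ k) ^ 2 := by ring
  rw [pow_succ, hpow] at hA
  rw [hpow] at hB
  have hq3' : (3 : ℝ) ≤ q := by exact_mod_cast hq3
  generalize (#E : ℝ) * #F = N at *
  generalize (#E : ℝ) = e at *
  generalize (q : ℝ) ^ k = p at *
  -- With |Δ| ≤ 1 the Plancherel bound forces 8(q-1) < q², false for 3 ≤ q ≤ 6; for q ≥ 7 the
  -- restriction bound is used with q/(q-1) ≤ 7/6.
  rcases le_or_gt q 6 with hq | hq
  · have hq' : (q : ℝ) ≤ 6 := by exact_mod_cast hq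
    have h1 : ((q : ℝ) - 1) * (8 * p ^ 2) < (q - 1) * N := by
      gcongr
      linarith
    have h2 : 0 ≤ p ^ 2 * (((q : ℝ) - 3) * (6 - q)) := by
      have : 0 ≤ ((q : ℝ) - 3) * (6 - q) := mul_nonneg (by linarith) (by linarith)
      positivity
    nlinarith [sq_nonneg p, mul_le_mul_of_nonneg_left hq' (sq_nonneg p), mul_le_mul_of_nonneg_left hq3' (sq_nonneg p)]
  · have hq' : (7 : ℝ) ≤ q := by exact_mod_cast hq
    have h1 : 6 * N ≤ 7 * (p ^ 2 + 2 * p * e) := by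
      have h2 : (q : ℝ) * (6 * N) ≤ q * (7 * (p ^ 2 + 2 * p * e)) := by
        nlinarith
      exact le_of_mul_le_mul_left h2 (by linarith)
    -- The square gives 14pe ≤ 19.6p² + 2.5e²; with 8p² < N and e² ≤ N this yields 6N < 6N.
    nlinarith [sq_nonneg (14 * p - 5 * e)]

theorem one_lt_card_distSet (hK : ringChar K ≠ 2) {k : ℕ} {E F : Finset (Fin (2 * k + 1) → K)}
    (h : 8 * Fintype.card K ^ (2 * k) < #E * #F) : 1 < #(distSet E F) := by
  rcases le_total #E #F with hEF | hEF
  · exact one_lt_card_distSet_of_card_le hK hEF h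
  · rw [distSet_comm]
    exact one_lt_card_distSet_of_card_le hK hEF (by rwa [mul_comm #F])

end DistanceSets

theorem theorem3p3 {K : Type*} [Field K] [Fintype K] [DecidableEq K] (hK : ringChar K ≠ 2)
    (d : ℕ) (hd3 : 3 ≤ d) (hd : Odd d) (q : ℕ) (hq : Fintype.card K = q)
    (E F : Finset (Fin d → K)) :
    (1 ≤ E.card → E.card < q ^ ((d - 1) / 2) →
      min ((q : ℝ) / 2) ((E.card : ℝ) * (F.card : ℝ) / (8 * (q : ℝ) ^ (d - 1)))
        ≤ ((distSet E F).card : ℝ)) ∧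
    (q ^ ((d - 1) / 2) ≤ E.card → E.card < q ^ ((d + 1) / 2) →
      min ((q : ℝ) / 2) ((F.card : ℝ) / (8 * (q : ℝ) ^ ((d - 1) / 2)))
        ≤ ((distSet E F).card : ℝ)) ∧
    (q ^ ((d + 1) / 2) ≤ E.card →
      min ((q : ℝ) / 2) ((E.card : ℝ) * (F.card : ℝ) / (2 * (q : ℝ) ^ d))
        ≤ ((distSet E F).card : ℝ)) ∧
    (8 * q ^ (d - 1) < E.card * F.card → 1 < (distSet E F).card) := by
  obtain ⟨k, rfl⟩ := hd
  rw [show (2 * k + 1 - 1) / 2 = k by omega, show (2 * k + 1 + 1) / 2 = k + 1 by omega,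
    show 2 * k + 1 - 1 = 2 * k by omega]
  subst hq
  have hq : (0 : ℝ) < Fintype.card K := by exact_mod_cast Fintype.card_pos
  rcases Nat.eq_zero_or_pos #F with hF | hF
  · simp [hF]
  have hF' : (0 : ℝ) < #F := by exact_mod_cast hF
  refine ⟨fun hE hE2 => ?_, fun hE _ => ?_, fun hE => ?_, one_lt_card_distSet hK⟩
  · have hE' : (0 : ℝ) < #E := by exact_mod_cast hE
    have hE2' : (#E : ℝ) ≤ (Fintype.card K : ℝ) ^ k := by exact_mod_cast hE2.le
    have h := card_mul_le_card_distSet_mul_of_odd hK hE hF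
    -- Since |E| ≤ q^k, the restriction bound is at most 3q^(2k); the 4 matches the stated constant
    -- 8.
    have := min_half_div_le_of_mul_le (D := #(distSet E F))
      (B := 4 * (Fintype.card K : ℝ) ^ (2 * k)) (mul_pos hE' hF') (by positivity) (h.trans ?_) hq
    · convert this using 3
      ring
    · gcongr
      calc _ ≤ (Fintype.card K : ℝ) ^ (2 * k) +
              2 * (Fintype.card K : ℝ) ^ k * (Fintype.card K : ℝ) ^ k := by gcongr
        _ = 3 * (Fintype.card K : ℝ) ^ (2 * k) := by ring
        _ ≤ _ := by gcongr; norm_num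
  · have hE0 : 0 < #E := (pow_pos Fintype.card_pos k).trans_le hE
    have hE' : (0 : ℝ) < #E := by exact_mod_cast hE0
    have hE2' : (Fintype.card K : ℝ) ^ k ≤ #E := by exact_mod_cast hE
    have h := card_mul_le_card_distSet_mul_of_odd hK hE0 hF
    -- Now q^k ≤ |E|, so 2q^k|E| dominates, and |E| cancels from the quotient.
    have := min_half_div_le_of_mul_le (D := #(distSet E F))
      (B := 4 * (Fintype.card K : ℝ) ^ k * #E) (mul_pos hE' hF') (by positivity) (h.trans ?_) hq
    · convert this using 2
      field_simp
      norm_num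
    · gcongr
      calc _ = (Fintype.card K : ℝ) ^ k * (Fintype.card K : ℝ) ^ k +
              2 * (Fintype.card K : ℝ) ^ k * #E := by ring
        _ ≤ (Fintype.card K : ℝ) ^ k * #E + 2 * (Fintype.card K : ℝ) ^ k * #E := by gcongr
        _ = 3 * (Fintype.card K : ℝ) ^ k * #E := by ring
        _ ≤ _ := by gcongr; norm_num
  · have hE0 : 0 < #E := (pow_pos Fintype.card_pos (k + 1)).trans_le hE
    have hE' : (0 : ℝ) < #E := by exact_mod_cast hE0
    exact min_half_div_le_of_mul_le (mul_pos hE' hF') (by positivity)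
      (card_mul_le_card_distSet_mul_pow hK hE0 hF) hq
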